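/- Let $(\mathcal X,\rho)$ be a compact metric space of diameter $\Delta$, $B(x,r)$ its closed balls, and suppose that the class $\mathcal B$ of all balls has finite VC dimension $\mathcal V_{\mathcal B}$. Let $P_X,Q_X$ be Borel probability measures on $\mathcal X$ (the source and target feature marginals) and $\mathcal X_Q$ the support of $Q_X$. Let $d\ge 1$, $\gamma\in[0,\infty]$, $C_\gamma\in(0,1]$, $C'>0$, and assume: (i) (transfer exponent $\gamma$) there is a measurable $\mathcal X_Q^\gamma\subset\mathcal X_Q$ with $Q_X(\mathcal X_Q^\gamma)=1$ such that $P_X(B(x,r))\ge Q_X(B(x,r))\,C_\gamma\,(r/\Delta)^\gamma$ for all $x\in\mathcal X_Q^\gamma$ and $r\in(0,\Delta]$ (for $\gamma=\infty$ the right-hand side is read as $0$); (ii) (upper-bounded ball mass) $Q_X(B(x,r))\le C'(r/\Delta)^d$ for all $x\in\mathcal X_Q$ and $r\in[0,\Delta]$. Let $0<\delta<1$, let $n_P,n_Q\ge 0$ be integers with $n_P\vee n_Q\ge1$, set $k_0=\lceil \mathcal V_{\mathcal B}\log(2(n_P+n_Q))+\log(6/\delta)\rceil$ and $\mathcal K=\{2^ik_0: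 0\le i\le\lfloor\log_2((n_P\vee n_Q)/(2k_0))\rfloor\}$ (empty if the upper limit is negative). Given a sample $X_1,\dots,X_{n_P+n_Q}$ and $R\subset[n_P+n_Q]$, say that $X_i$ is $k$-covered by $R$ if some choice of the $2k$ nearest neighbors of $X_i$ in the whole sample ($X_i$ itself included, ties broken in any way) contains at least $k$ points with index in $R$; $R$ is a $k$-$2k$ cover if every $X_i$ with $i\notin R$ is $k$-covered by $R$. Consider the following algorithm: start with $R=[n_P]$; for each $k\in\mathcal K$ in increasing order, add to $R$ all target indices $i\in(n_P,n_P+n_Q]$ such that $X_i$ is not $k$-covered by the current $R$; finally, query the labels of the target points with index in $R$. Then the set $R$ so constructed is simultaneously a $k$-$2k$ cover for all $k\in\mathcal K$. Moreover, there is a constant $C>0$ that depends only on $\gamma$, $d$ and the associated constants $C_\gamma, C'$, such that, whenever $n_P^{d/(d+\gamma)}\ge C\,n_Q$ (with exponent $0$ if $\gamma=\infty$), with probability at least $1-\delta$ over independent samples $(X_1,\dots,X_{n_P})\sim P_X^{n_P}$ and $(X_{n_P+1},\dots,X_{n_P+n_Q})\sim Q_X^{n_Q}$, the algorithm makes no target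 label query. -/

import Mathlib

open MeasureTheory Set
open scoped ENNReal

noncomputable section

namespace LabelingThreshold

section Balls

variable {X : Type*}

/-- The class of sets `𝓒` shatters the finite set `A`: every subset of `A` is the trace on `A` of
a member of `𝓒`. -/
def Shatters (𝓒 : Set (Set X)) (A : Finset X) : Prop :=
  ∀ T : Finset X, T ⊆ A → ∃ B ∈ 𝓒, B ∩ (A : Set X) = (T : Set X)

/-- The class `𝓒` has finite VC dimension, equal to `V`: the largest cardinality of a finite set
shattered by `𝓒` exists and is `V`. -/
def HasVCDim (𝓒 : Set (Set X)) (V : ℕ) : Prop :=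
  IsGreatest {n : ℕ | ∃ A : Finset X, A.card = n ∧ Shatters 𝓒 A} V

/-- The class of all closed balls `B(x, r)`, `r ≥ 0`, of a metric space. -/
def closedBalls (X : Type*) [MetricSpace X] : Set (Set X) :=
  {B | ∃ (x : X) (r : ℝ), 0 ≤ r ∧ B = Metric.closedBall x r}

end Balls

section Distributions

variable {X : Type*} [MetricSpace X] [MeasurableSpace X]

/-- `t ^ γ` for `0 ≤ t` and `γ ∈ [0, ∞]`, with the convention `t ^ ∞ = 0`, under which the
transfer condition for `γ = ∞` reads `P (B(x, r)) ≥ 0`. -/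
def transferPow (t : ℝ) (γ : ℝ≥0∞) : ℝ :=
  if γ = ⊤ then 0 else t ^ γ.toReal

/-- The pair of feature marginals `(P, Q)` has transfer exponent `γ` with constant `Cγ`. -/
def HasTransferExponent (P Q : Measure X) (γ : ℝ≥0∞) (Cγ : ℝ) : Prop :=
  ∃ A : Set X, MeasurableSet A ∧ A ⊆ Q.support ∧ Q A = 1 ∧
    ∀ x ∈ A, ∀ r ∈ Ioc (0 : ℝ) (Metric.diam (univ : Set X)),
      Q.real (Metric.closedBall x r) * Cγ * transferPow (r / Metric.diam (univ : Set X)) γ ≤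
        P.real (Metric.closedBall x r)

/-- Upper-bounded ball mass: `Q (B(x, r)) ≤ C' (r / Δ) ^ d` for `x` in the support of `Q` and
`0 ≤ r ≤ Δ`, where `Δ` is the diameter of the space. -/
def HasBoundedBallMass (Q : Measure X) (d C' : ℝ) : Prop :=
  ∀ r ∈ Icc (0 : ℝ) (Metric.diam (univ : Set X)), ∀ x ∈ Q.support,
    Q.real (Metric.closedBall x r) ≤ C' * (r / Metric.diam (univ : Set X)) ^ d

/-- The exponent `d / (d + γ)` for `γ ∈ [0, ∞]`; it is `0` for `γ = ∞`. -/
def thresholdExponent (d : ℝ) (γ : ℝ≥0∞) : ℝ :=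
  if γ = ⊤ then 0 else d / (d + γ.toReal)

/-- The law of the two independent i.i.d. feature samples, `P ^ nP × Q ^ nQ`. -/
def sampleLaw (P Q : Measure X) (nP nQ : ℕ) : Measure ((Fin nP → X) × (Fin nQ → X)) :=
  (Measure.pi fun _ : Fin nP => P).prod (Measure.pi fun _ : Fin nQ => Q)

end Distributions

section Covers

variable {X : Type*} [MetricSpace X] {nP nQ : ℕ}

/-- The combined sample, indexed by the disjoint union of source and target indices. -/
def combined (x : (Fin nP → X) × (Fin nQ → X)) : Fin nP ⊕ Fin nQ → X :=
  Sum.elim x.1 x.2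

/-- `S` is a possible choice of the `m` nearest neighbors of the sample point `x i` in the whole
sample `x`, the point `x i` itself included. -/
def IsNNChoice {ι : Type*} (x : ι → X) (i : ι) (m : ℕ) (S : Finset ι) : Prop :=
  i ∈ S ∧ S.card = m ∧ ∀ a ∈ S, ∀ b ∉ S, dist (x a) (x i) ≤ dist (x b) (x i)

open Classical in
/-- At least one of the possible choices of the `2k` nearest neighbors of `x i` in the sample
contains at least `k` sample points with index in `R`. -/
def CoveredAt {ι : Type*} (x : ι → X) (R : Finset ι) (k : ℕ) (i : ι) : Prop :=
  ∃ S : Finset ι, IsNNChoice x i (2 * k) S ∧ k ≤ (S ∩ R).card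

/-- The subsample indexed by `R` is a `k`-`2k` cover of the sample `x`. -/
def IsCover {ι : Type*} (x : ι → X) (R : Finset ι) (k : ℕ) : Prop :=
  ∀ i, i ∈ R ∨ CoveredAt x R k i

/-- `k₀ = ⌈V log (2 (nP + nQ)) + log (6 / δ)⌉`. -/
def kZero (V nP nQ : ℕ) (δ : ℝ) : ℕ :=
  ⌈(V : ℝ) * Real.log (2 * ((nP : ℝ) + nQ)) + Real.log (6 / δ)⌉₊

/-- The increasing list of the values `k = 2 ^ i k₀` with
`0 ≤ i ≤ ⌊log₂ ((nP ∨ nQ) / (2 k₀))⌋` (an empty list if this upper limit is negative). -/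
def kRange (nP nQ k₀ : ℕ) : List ℕ :=
  (List.range (⌊Real.logb 2 ((max nP nQ : ℕ) / (2 * (k₀ : ℝ)))⌋ + 1).toNat).map
    fun i => 2 ^ i * k₀

open Classical in
/-- One round of the construction: add the indices of all target points which do not have `k`
points of the current subsample among their `2k` nearest neighbors. -/
def coverStep (x : (Fin nP → X) × (Fin nQ → X)) (R : Finset (Fin nP ⊕ Fin nQ)) (k : ℕ) :
    Finset (Fin nP ⊕ Fin nQ) :=
  R ∪ Finset.univ.filter fun i => i.isRight = true ∧ ¬ CoveredAt (combined x) R k i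

/-- The source indices `[nP]`. -/
def sourceIndices (nP nQ : ℕ) : Finset (Fin nP ⊕ Fin nQ) :=
  Finset.univ.filter fun i => i.isLeft = true

/-- The algorithm: start from the source indices and perform one round for each `k` in the range,
in increasing order. -/
def buildCover (k₀ : ℕ) (x : (Fin nP → X) × (Fin nQ → X)) : Finset (Fin nP ⊕ Fin nQ) :=
  (kRange nP nQ k₀).foldl (coverStep x) (sourceIndices nP nQ)

/-- The target points whose labels are queried: those with index in the constructed set. -/
def queried (k₀ : ℕ) (x : (Fin nP → X) × (Fin nQ → X)) : Finset (Fin nQ) :=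
  Finset.univ.filter fun j => Sum.inr j ∈ buildCover k₀ x

end Covers

end LabelingThreshold

end

/-!
# The threshold on the source sample size beyond which no label is queried

The set built by the algorithm is a cover at every scale because a target point left out in the
round for `k` is `k`-covered at that time, and enlarging the set preserves this.

No label is queried as soon as the source sample alone covers every target point at every scale.
Fix a target point `y` and a scale `k`. If `k ≥ nQ`, then at most `k` of the `2 k` neighbors are
target points. Otherwise let `r` be the smallest radius for which the closed ball about `y` has
target mass at least `t = k / (8 nQ)`; the open ball then has mass at most `t`. With probability at
least `1 - exp (-k)` each:

* the open ball holds at most `k` target points (`measure_lt_target_count_le`), because the expected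
  number of them is at most `k / 8`;
* the closed ball holds at least `k` source points (`measure_source_count_lt_le`). The upper bound
  on ball masses forces `r / Δ ≥ (t / C') ^ (1 / d)`, so the transfer condition gives source mass at
  least a constant times `t ^ (1 + γ / d)`, and the assumption on the sample sizes makes the
  expected number of source points at least `4 k` (`four_mul_le_mul_mass`).

Both events together imply that `y` is covered, if ties on the sphere of radius `r` are broken in
favour of the source (`coveredAt_of_card`).

Conditionally on its center each ball is fixed, so Chernoff bounds and a union bound over target
points and scales suffice, and no uniform deviation inequality over the class of balls is needed.
The VC dimension enters only through `V ≥ 1`, which gives `exp (-k₀) ≤ δ / (12 (nP + nQ))`; the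
scales grow geometrically, so the sum over them is of the order of its first term.
-/

namespace LabelingThreshold

/-! ### The cover property of the constructed set -/

section CoverProperty

variable {X : Type*} [MetricSpace X] {nP nQ : ℕ}

theorem coveredAt_iff {ι : Type*} [DecidableEq ι] {x : ι → X} {R : Finset ι} {k : ℕ} {i : ι} :
    CoveredAt x R k i ↔ ∃ S : Finset ι, IsNNChoice x i (2 * k) S ∧ k ≤ (S ∩ R).card := by
  unfold CoveredAt
  congr!

theorem CoveredAt.mono {ι : Type*} {x : ι → X} {R R' : Finset ι} (h : R ⊆ R') {k : ℕ} {i : ι}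
    (hc : CoveredAt x R k i) : CoveredAt x R' k i := by
  classical
  obtain ⟨S, hS, hk⟩ := coveredAt_iff.1 hc
  exact coveredAt_iff.2 ⟨S, hS, hk.trans (Finset.card_le_card (Finset.inter_subset_inter_left h))⟩

theorem subset_coverStep (x : (Fin nP → X) × (Fin nQ → X)) (R : Finset (Fin nP ⊕ Fin nQ)) (k : ℕ) :
    R ⊆ coverStep x R k :=
  Finset.subset_union_left

theorem subset_foldl_coverStep (x : (Fin nP → X) × (Fin nQ → X)) (l : List ℕ)
    (R : Finset (Fin nP ⊕ Fin nQ)) : R ⊆ l.foldl (coverStep x) R := by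
  induction l generalizing R with
  | nil => exact subset_rfl
  | cons k l ih => exact (subset_coverStep x R k).trans (ih _)

theorem inr_mem_coverStep_or_coveredAt (x : (Fin nP → X) × (Fin nQ → X))
    (R : Finset (Fin nP ⊕ Fin nQ)) (k : ℕ) (j : Fin nQ) :
    Sum.inr j ∈ coverStep x R k ∨ CoveredAt (combined x) R k (Sum.inr j) := by
  classical
  by_cases h : CoveredAt (combined x) R k (Sum.inr j)
  · exact Or.inr h
  · exact Or.inl (by simp [coverStep, h])

/-- A target point that stays out of the set after the round for `k` was covered then, and the
later rounds only enlarge the set. -/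
theorem inr_mem_foldl_or_coveredAt (x : (Fin nP → X) × (Fin nQ → X)) (l : List ℕ)
    (R : Finset (Fin nP ⊕ Fin nQ)) {k : ℕ} (hk : k ∈ l) (j : Fin nQ) :
    Sum.inr j ∈ l.foldl (coverStep x) R ∨
      CoveredAt (combined x) (l.foldl (coverStep x) R) k (Sum.inr j) := by
  induction l generalizing R with
  | nil => simp at hk
  | cons a l ih =>
    rcases List.mem_cons.1 hk with rfl | hk
    · have hsub := subset_foldl_coverStep x l (coverStep x R k)
      exact (inr_mem_coverStep_or_coveredAt x R k j).imp (fun h => hsub h)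
        (fun h => h.mono ((subset_coverStep x R k).trans hsub))
    · exact ih _ hk

theorem isCover_buildCover (k₀ : ℕ) (x : (Fin nP → X) × (Fin nQ → X)) {k : ℕ}
    (hk : k ∈ kRange nP nQ k₀) : IsCover (combined x) (buildCover k₀ x) k := by
  rintro (i | j)
  · exact Or.inl (subset_foldl_coverStep x _ _ (by simp [sourceIndices]))
  · exact inr_mem_foldl_or_coveredAt x _ _ hk j

/-- If the source sample alone covers every target point at every scale, no round adds anything,
so no label is queried. -/
theorem queried_eq_empty (k₀ : ℕ) (x : (Fin nP → X) × (Fin nQ → X))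
    (h : ∀ k ∈ kRange nP nQ k₀, ∀ j, CoveredAt (combined x) (sourceIndices nP nQ) k (Sum.inr j)) :
    queried k₀ x = ∅ := by
  classical
  have hfold : ∀ l : List ℕ, (∀ k ∈ l, ∀ j,
      CoveredAt (combined x) (sourceIndices nP nQ) k (Sum.inr j)) →
      l.foldl (coverStep x) (sourceIndices nP nQ) = sourceIndices nP nQ := by
    intro l
    induction l with
    | nil => exact fun _ => rfl
    | cons k l ih =>
      intro hl
      have hstep : coverStep x (sourceIndices nP nQ) k = sourceIndices nP nQ := by
        refine Finset.union_eq_left.2 ?_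
        rintro (i | j) hi
        · simp at hi
        · simp [hl k List.mem_cons_self j] at hi
      rw [List.foldl_cons, hstep]
      exact ih fun k hk => hl k (List.mem_cons_of_mem _ hk)
  ext j
  rw [queried, buildCover, hfold _ h]
  simp [sourceIndices]

end CoverProperty

/-! ### A sufficient condition for being covered -/

section Criterion

theorem exists_finset_card_eq_forall_le {ι α : Type*} [Fintype ι] [LinearOrder α] (g : ι → α)
    {m : ℕ} (hm : m ≤ Fintype.card ι) :
    ∃ S : Finset ι, S.card = m ∧ ∀ a ∈ S, ∀ b ∉ S, g a ≤ g b := by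
  classical
  induction m with
  | zero => exact ⟨∅, by simp⟩
  | succ m ih =>
    obtain ⟨S, hS, hle⟩ := ih (by omega)
    have hne : (Sᶜ : Finset ι).Nonempty := by
      rw [← Finset.card_pos, Finset.card_compl]; omega
    obtain ⟨c, hc, hmin⟩ := Finset.exists_min_image Sᶜ g hne
    have hcS := Finset.mem_compl.1 hc
    refine ⟨insert c S, by rw [Finset.card_insert_of_notMem hcS, hS], ?_⟩
    intro a ha b hb
    rw [Finset.mem_insert, not_or] at hb
    rcases Finset.mem_insert.1 ha with rfl | ha
    · exact hmin b (Finset.mem_compl.2 hb.2)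
    · exact hle a ha b hb.2

variable {X : Type*} [MetricSpace X] {nP nQ : ℕ}

open Classical in
/-- If at most `k` target points lie in an open ball about a target point and at least `k` source
points lie in the closed ball of the same radius, then breaking ties in favour of the source
makes at least `k` of the `2k` nearest neighbors source points. -/
theorem coveredAt_of_card {x : (Fin nP → X) × (Fin nQ → X)} {j : Fin nQ} {k : ℕ} {r : ℝ}
    (hk : 0 < k) (hcard : 2 * k ≤ nP + nQ) (hr : 0 < r)
    (hQ : (Finset.univ.filter fun b => x.2 b ∈ Metric.ball (x.2 j) r).card ≤ k)
    (hP : k ≤ (Finset.univ.filter fun a => x.1 a ∈ Metric.closedBall (x.2 j) r).card) :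
    CoveredAt (combined x) (sourceIndices nP nQ) k (Sum.inr j) := by
  -- Order by distance; among equal distances, first the center, then source, then target points.
  let g : Fin nP ⊕ Fin nQ → ℝ ×ₗ ℕ := fun b =>
    toLex (dist (combined x b) (x.2 j), if b = Sum.inr j then 0 else if b.isLeft then 1 else 2)
  obtain ⟨S, hS, hle⟩ := exists_finset_card_eq_forall_le g (m := 2 * k) (by simpa using hcard)
  have hgj : g (Sum.inr j) = toLex (0, 0) := by simp [g, combined]
  have hjS : Sum.inr j ∈ S := by
    by_contra hj
    obtain ⟨a, ha⟩ : S.Nonempty := Finset.card_pos.1 (by omega)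
    have h1 := hle a ha _ hj
    have haj : a ≠ Sum.inr j := fun h => hj (h ▸ ha)
    rw [hgj, Prod.Lex.le_iff] at h1
    rcases h1 with h1 | h1
    · exact absurd h1 (not_lt.2 dist_nonneg)
    · have := h1.2
      by_cases hl : a.isLeft = true <;> simp [g, haj, hl] at this
  refine coveredAt_iff.2 ⟨S, ⟨hjS, hS, fun a ha b hb => ?_⟩, ?_⟩
  · rcases (Prod.Lex.le_iff.1 (hle a ha b hb)) with h | h
    · exact h.le
    · exact h.1.le
  let T : Finset (Fin nP ⊕ Fin nQ) :=
    (Finset.univ.filter fun b => x.2 b ∈ Metric.ball (x.2 j) r).map Function.Embedding.inr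
  let U : Finset (Fin nP ⊕ Fin nQ) :=
    (Finset.univ.filter fun a => x.1 a ∈ Metric.closedBall (x.2 j) r).map Function.Embedding.inl
  have hT : T.card ≤ k := by simpa [T] using hQ
  have hU : k ≤ U.card := by simpa [U] using hP
  -- Either all target points among the neighbors lie in the open ball, or one does not, and then
  -- all source points of the closed ball precede it.
  by_cases hfar : ∃ b, Sum.inr b ∈ S ∧ r ≤ dist (x.2 b) (x.2 j)
  · obtain ⟨b, hbS, hb⟩ := hfar
    refine hU.trans (Finset.card_le_card fun u hu => ?_)
    obtain ⟨a, ha, rfl⟩ := Finset.mem_map.1 hu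
    have ha' : dist (x.1 a) (x.2 j) ≤ r := by simpa using ha
    refine Finset.mem_inter.2 ⟨?_, by simp [sourceIndices]⟩
    by_contra haS
    have hbj : b ≠ j := by
      rintro rfl
      rw [dist_self] at hb
      linarith
    have h := hle _ hbS _ haS
    rw [Prod.Lex.le_iff] at h
    rcases h with h | h
    · have : dist (x.2 b) (x.2 j) < dist (x.1 a) (x.2 j) := h
      linarith
    · have := h.2
      simp [g, hbj] at this
  · push Not at hfar
    have hsub : S \ sourceIndices nP nQ ⊆ T := by
      rintro (a | b) hb
      · simp [sourceIndices] at hb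
      · simpa [T] using hfar b (Finset.mem_sdiff.1 hb).1
    have h1 := Finset.card_sdiff_add_card_inter S (sourceIndices nP nQ)
    have h2 := Finset.card_le_card hsub
    omega

end Criterion

/-! ### Chernoff bounds for empirical counts -/

section Chernoff

variable {X : Type*}

open Classical in
/-- The number of entries of the finite sample `y` that lie in `B`. -/
noncomputable def countIn {n : ℕ} (B : Set X) (y : Fin n → X) : ℕ :=
  (Finset.univ.filter fun j => y j ∈ B).card

theorem countIn_le {n : ℕ} (B : Set X) (y : Fin n → X) : countIn B y ≤ n := by
  classical
  simpa [countIn] using Finset.card_filter_le (Finset.univ : Finset (Fin n)) (fun j => y j ∈ B)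

theorem measurable_countIn {Ω : Type*} [MeasurableSpace Ω] {n : ℕ} {B : Ω → Set X}
    {Y : Ω → Fin n → X} (h : ∀ j, MeasurableSet {ω | Y ω j ∈ B ω}) :
    Measurable fun ω => countIn (B ω) (Y ω) := by
  classical
  simp only [countIn, Finset.card_filter]
  exact Finset.measurable_sum _ fun j _ => Measurable.ite (h j) measurable_const measurable_const

theorem exp_mul_countIn {n : ℕ} (B : Set X) (s : ℝ) (y : Fin n → X) :
    Real.exp (s * countIn B y) = ∏ j, (1 + B.indicator (fun _ => Real.exp s - 1) (y j)) := by
  classical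
  have h : ∀ j, 1 + B.indicator (fun _ => Real.exp s - 1) (y j) =
      if y j ∈ B then Real.exp s else 1 := by
    intro j
    by_cases hj : y j ∈ B <;> simp [hj]
  simp_rw [h]
  rw [Finset.prod_ite, Finset.prod_const, Finset.prod_const_one, mul_one, ← Real.exp_nat_mul,
    mul_comm]
  rfl

variable [MeasurableSpace X] (μ : Measure X) [IsProbabilityMeasure μ] {B : Set X}

theorem integrable_exp_mul_countIn (hB : MeasurableSet B) (n : ℕ) (s : ℝ) :
    Integrable (fun y => Real.exp (s * countIn B y)) (Measure.pi fun _ : Fin n => μ) := by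
  have hm : Measurable fun y : Fin n → X => countIn B y :=
    measurable_countIn fun j => measurable_pi_apply j hB
  refine Integrable.of_bound (C := Real.exp (|s| * n)) ?_ (Filter.Eventually.of_forall fun y => ?_)
  · exact (Real.measurable_exp.comp
      ((measurable_from_top.comp hm).const_mul s)).aestronglyMeasurable
  · rw [Real.norm_eq_abs, Real.abs_exp, Real.exp_le_exp]
    have h : (countIn B y : ℝ) ≤ n := by exact_mod_cast countIn_le B y
    exact mul_le_mul (le_abs_self s) h (Nat.cast_nonneg _) (abs_nonneg _)

theorem mgf_countIn_le (hB : MeasurableSet B) (n : ℕ) (s : ℝ) :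
    ProbabilityTheory.mgf (fun y => (countIn B y : ℝ)) (Measure.pi fun _ : Fin n => μ) s ≤
      Real.exp (n * μ.real B * (Real.exp s - 1)) := by
  have hint : ∫ y, (1 + B.indicator (fun _ => Real.exp s - 1) y) ∂μ =
      1 + μ.real B * (Real.exp s - 1) := by
    rw [integral_add (integrable_const _) ((integrable_const _).indicator hB),
      integral_indicator_const _ hB]
    simp
  have h0 : 0 ≤ 1 + μ.real B * (Real.exp s - 1) := by
    rw [← hint]
    refine integral_nonneg fun y => ?_
    by_cases hy : y ∈ B <;> simp [hy, Real.exp_nonneg]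
  simp only [ProbabilityTheory.mgf, exp_mul_countIn]
  rw [integral_fintype_prod_eq_prod
    (fun (_ : Fin n) y => 1 + B.indicator (fun _ => Real.exp s - 1) y), Finset.prod_const,
    Finset.card_univ, Fintype.card_fin, hint, mul_assoc, Real.exp_nat_mul]
  refine pow_le_pow_left₀ h0 ?_ n
  linarith [Real.add_one_le_exp (μ.real B * (Real.exp s - 1))]

/-- A count whose mean is at least `4 k` falls below `k` with probability at most `e⁻ᵏ`. -/
theorem measure_countIn_lt_le (hB : MeasurableSet B) {n k : ℕ} (h : 4 * (k : ℝ) ≤ n * μ.real B) :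
    Measure.pi (fun _ : Fin n => μ) {y | countIn B y < k} ≤ ENNReal.ofReal (Real.exp (-k)) := by
  have h1 := ProbabilityTheory.measure_le_le_exp_mul_mgf (X := fun y => (countIn B y : ℝ))
    (μ := Measure.pi fun _ : Fin n => μ) (t := -1) k (by norm_num)
    (integrable_exp_mul_countIn μ hB n (-1))
  have hexp : Real.exp (-1) ≤ 1 / 2 := by
    rw [Real.exp_neg, one_div]
    exact inv_anti₀ two_pos (by linarith [Real.add_one_le_exp (1 : ℝ)])
  have h2 : (Measure.pi fun _ : Fin n => μ).real {y | (countIn B y : ℝ) ≤ k} ≤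
      Real.exp (-k) := by
    refine (h1.trans (mul_le_mul_of_nonneg_left (mgf_countIn_le μ hB n (-1))
      (Real.exp_nonneg _))).trans ?_
    rw [← Real.exp_add, Real.exp_le_exp]
    nlinarith
  refine (measure_mono fun y hy => ?_).trans ((ENNReal.le_ofReal_iff_toReal_le
    (measure_ne_top _ _) (Real.exp_nonneg _)).2 h2)
  exact Nat.cast_le (α := ℝ).2 (le_of_lt hy)

/-- A count whose mean is at most `k / 8` reaches `k` with probability at most `e⁻ᵏ`. -/
theorem measure_le_countIn_le (hB : MeasurableSet B) {n k : ℕ} (h : 8 * (n * μ.real B) ≤ k) :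
    Measure.pi (fun _ : Fin n => μ) {y | k ≤ countIn B y} ≤ ENNReal.ofReal (Real.exp (-k)) := by
  have h1 := ProbabilityTheory.measure_ge_le_exp_mul_mgf (X := fun y => (countIn B y : ℝ))
    (μ := Measure.pi fun _ : Fin n => μ) (t := 2) k (by norm_num)
    (integrable_exp_mul_countIn μ hB n 2)
  have hexp : Real.exp 2 ≤ 8 := by
    have h3 : Real.exp 2 = Real.exp 1 * Real.exp 1 := by rw [← Real.exp_add]; norm_num
    have := Real.exp_one_lt_d9
    have := Real.exp_pos 1
    nlinarith
  have h2 : (Measure.pi fun _ : Fin n => μ).real {y | (k : ℝ) ≤ countIn B y} ≤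
      Real.exp (-k) := by
    refine (h1.trans (mul_le_mul_of_nonneg_left (mgf_countIn_le μ hB n 2)
      (Real.exp_nonneg _))).trans ?_
    rw [← Real.exp_add, Real.exp_le_exp]
    have : 0 ≤ n * μ.real B := by positivity
    nlinarith
  refine (measure_mono fun y hy => ?_).trans ((ENNReal.le_ofReal_iff_toReal_le
    (measure_ne_top _ _) (Real.exp_nonneg _)).2 h2)
  exact Nat.cast_le (α := ℝ).2 hy

end Chernoff

/-! ### Balls of prescribed mass -/

section Radius

variable {X : Type*} [MetricSpace X] [CompactSpace X]

theorem closedBall_diam_eq_univ (y : X) : Metric.closedBall y (Metric.diam (univ : Set X)) = univ :=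
  eq_univ_of_forall fun _ => Metric.mem_closedBall.2
    (Metric.dist_le_diam_of_mem isCompact_univ.isBounded (mem_univ _) (mem_univ _))

variable [MeasurableSpace X] [BorelSpace X]

/-- Spheres may carry mass, so a ball of mass exactly `t` need not exist; the smallest radius whose
closed ball has mass at least `t` gives an open ball of mass at most `t`, and it depends measurably
on the center. -/
theorem exists_measurable_radius (Q : Measure X) [IsProbabilityMeasure Q] {t : ℝ≥0∞} (ht : t ≤ 1)
    (ht0 : t ≠ 0) :
    ∃ r : X → ℝ, Measurable r ∧ ∀ y, r y ∈ Icc 0 (Metric.diam (univ : Set X)) ∧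
      Q (Metric.ball y (r y)) ≤ t ∧ t ≤ Q (Metric.closedBall y (r y)) := by
  let s : X → Set ℝ := fun y => {a | t ≤ Q (Metric.closedBall y a)}
  have hdiam : ∀ y, Metric.diam (univ : Set X) ∈ s y := fun y => by
    simpa [s, closedBall_diam_eq_univ y] using ht
  have hnonneg : ∀ y, ∀ a ∈ s y, 0 ≤ a := fun y a ha => by
    by_contra h
    have ha' : t ≤ Q (Metric.closedBall y a) := ha
    rw [Metric.closedBall_eq_empty.2 (not_le.1 h), measure_empty] at ha'
    exact ht0 (le_antisymm ha' zero_le)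
  have hbdd : ∀ y, BddBelow (s y) := fun y => ⟨0, hnonneg y⟩
  have hmem : ∀ y, sInf (s y) ∈ s y := by
    intro y
    obtain ⟨u, hu, hugt, hulim⟩ := exists_seq_strictAnti_tendsto (sInf (s y))
    have hinter : Metric.closedBall y (sInf (s y)) = ⋂ n, Metric.closedBall y (u n) := by
      ext z
      simp only [Metric.mem_closedBall, mem_iInter]
      exact ⟨fun h n => h.trans (hugt n).le, fun h => ge_of_tendsto' hulim h⟩
    have hanti : Antitone fun n => Metric.closedBall y (u n) :=
      fun m n hmn => Metric.closedBall_subset_closedBall (hu.antitone hmn)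
    change t ≤ Q _
    rw [hinter, hanti.measure_iInter (fun n => Metric.isClosed_closedBall.nullMeasurableSet)
      ⟨0, measure_ne_top _ _⟩]
    refine le_iInf fun n => ?_
    obtain ⟨a, ha, hau⟩ := exists_lt_of_csInf_lt ⟨_, hdiam y⟩ (hugt n)
    exact le_trans ha (measure_mono (Metric.closedBall_subset_closedBall hau.le))
  refine ⟨fun y => sInf (s y), measurable_of_Iic fun a => ?_, fun y =>
    ⟨⟨hnonneg y _ (hmem y), csInf_le (hbdd y) (hdiam y)⟩, ?_, hmem y⟩⟩
  · have h : (fun y => sInf (s y)) ⁻¹' Iic a = {y | t ≤ Q (Metric.closedBall y a)} := by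
      ext y
      refine ⟨fun h => ?_, fun h => csInf_le (hbdd y) h⟩
      exact le_trans (hmem y) (measure_mono (Metric.closedBall_subset_closedBall h))
    rw [h]
    have hm : MeasurableSet {p : X × X | dist p.2 p.1 ≤ a} :=
      (isClosed_le (continuous_snd.dist continuous_fst) continuous_const).measurableSet
    exact measurableSet_le measurable_const (measurable_measure_prodMk_left (ν := Q) hm)
  · obtain ⟨u, hu, hult, hulim⟩ := exists_seq_strictMono_tendsto (sInf (s y))
    have hunion : Metric.ball y (sInf (s y)) ⊆ ⋃ n, Metric.closedBall y (u n) := by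
      intro z hz
      obtain ⟨n, hn⟩ := (hulim.eventually (lt_mem_nhds (Metric.mem_ball.1 hz))).exists
      exact mem_iUnion.2 ⟨n, Metric.mem_closedBall.2 hn.le⟩
    have hmono : Monotone fun n => Metric.closedBall y (u n) :=
      fun m n hmn => Metric.closedBall_subset_closedBall (hu.monotone hmn)
    refine (measure_mono hunion).trans ?_
    rw [hmono.measure_iUnion]
    refine iSup_le fun n => ?_
    by_contra h
    exact absurd (csInf_le (hbdd y) (not_le.1 h).le) (not_le.2 (hult n))

end Radius

/-! ### Probability that a target point is not covered by the source sample -/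

section NotCovered

/-- The threshold on the sample sizes makes the expected number of source points in a ball large:
a ball of target mass `q ≥ k / (8 nQ)` cannot be small, by the upper bound on ball masses, and so
the transfer condition bounds its source mass `p` from below. Here `u` is the radius of the ball
relative to the diameter. -/
theorem four_mul_le_mul_mass {d g Cγ C' C : ℝ} (hd : 0 < d) (hg : 0 ≤ g) (hCγ : 0 < Cγ)
    (hC' : 0 < C') (hC₁ : 32 / Cγ ≤ C) (hC₂ : 8 * C' ≤ C) {nP nQ k p q u : ℝ} (hnP : 0 ≤ nP)
    (hnQ : 0 < nQ) (hk : 1 ≤ k) (hn : C * nQ ≤ nP ^ (d / (d + g))) (hu : 0 ≤ u)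
    (htq : k / (8 * nQ) ≤ q) (hqu : q ≤ C' * u ^ d) (hqp : q * Cγ * u ^ g ≤ p) :
    4 * k ≤ nP * p := by
  have hC : 0 < C := lt_of_lt_of_le (by positivity) hC₂
  set t : ℝ := k / (8 * nQ) with ht
  have ht0 : 0 < t := by positivity
  have hCn : 0 < C * nQ := by positivity
  have hlow : (C * nQ) * (C * nQ) ^ (g / d) ≤ nP := by
    have h := Real.rpow_le_rpow hCn.le hn (show 0 ≤ (d + g) / d by positivity)
    rw [← Real.rpow_mul hnP, show d / (d + g) * ((d + g) / d) = 1 by field_simp,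
      Real.rpow_one, show (d + g) / d = 1 + g / d by field_simp, Real.rpow_add hCn,
      Real.rpow_one] at h
    exact h
  have hug : (t / C') ^ (g / d) ≤ u ^ g := by
    have h : t / C' ≤ u ^ d := by
      rw [div_le_iff₀ hC', mul_comm]
      exact htq.trans hqu
    refine (Real.rpow_le_rpow (by positivity) h (by positivity)).trans_eq ?_
    rw [← Real.rpow_mul hu, show d * (g / d) = g by field_simp]
  have hp : t * Cγ * (t / C') ^ (g / d) ≤ p := by
    have hq : 0 ≤ q := ht0.le.trans htq
    refine le_trans ?_ hqp
    gcongr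
  have hone : 1 ≤ (C * nQ) ^ (g / d) * (t / C') ^ (g / d) := by
    rw [← Real.mul_rpow hCn.le (by positivity)]
    refine Real.one_le_rpow ?_ (by positivity)
    rw [ht, show C * nQ * (k / (8 * nQ) / C') = C * k / (8 * C') by field_simp, le_div_iff₀
      (by positivity)]
    nlinarith
  have hmain : 4 * k ≤ (C * nQ) * (t * Cγ) := by
    have h : 32 ≤ C * Cγ := (div_le_iff₀ hCγ).1 hC₁
    rw [ht, show C * nQ * (k / (8 * nQ) * Cγ) = C * Cγ * k / 8 by field_simp]
    nlinarith
  calc 4 * k ≤ (C * nQ) * (t * Cγ) * 1 := by rw [mul_one]; exact hmain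
    _ ≤ (C * nQ) * (t * Cγ) * ((C * nQ) ^ (g / d) * (t / C') ^ (g / d)) := by gcongr
    _ = ((C * nQ) * (C * nQ) ^ (g / d)) * (t * Cγ * (t / C') ^ (g / d)) := by ring
    _ ≤ nP * p := by gcongr

theorem prod_le_of_forall_ae_le {α β : Type*} [MeasurableSpace α] [MeasurableSpace β]
    (μ : Measure α) (ν : Measure β) [IsProbabilityMeasure μ] [SFinite ν] {E : Set (α × β)}
    (hE : MeasurableSet E) {ε : ℝ≥0∞} (h : ∀ᵐ x ∂μ, ν (Prod.mk x ⁻¹' E) ≤ ε) :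
    μ.prod ν E ≤ ε := by
  rw [Measure.prod_apply hE]
  exact (lintegral_mono_ae h).trans_eq (by simp)

theorem countIn_succ_le {X : Type*} {n : ℕ} (B : Set X) (y : Fin (n + 1) → X) (j : Fin (n + 1)) :
    countIn B y ≤ 1 + countIn B (fun i => y (j.succAbove i)) := by
  classical
  simp only [countIn, Finset.card_filter]
  rw [Fin.sum_univ_succAbove _ j]
  gcongr
  split_ifs <;> simp

/-- In a one-point space the relative radius is `0 / 0 = 0`, so the bound on ball masses would make
the whole space have mass zero. -/
theorem diam_pos_of_hasBoundedBallMass {X : Type*} [MetricSpace X] [CompactSpace X]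
    [MeasurableSpace X] {Q : Measure X} [IsProbabilityMeasure Q] {d C' : ℝ}
    (hd : 0 < d) (hQ : HasBoundedBallMass Q d C') (hne : Q.support.Nonempty) :
    0 < Metric.diam (univ : Set X) := by
  obtain ⟨x, hx⟩ := hne
  by_contra h
  have h0 : Metric.diam (univ : Set X) = 0 := le_antisymm (not_lt.1 h) Metric.diam_nonneg
  have h1 := hQ _ ⟨Metric.diam_nonneg, le_rfl⟩ x hx
  rw [closedBall_diam_eq_univ, h0, div_zero, Real.zero_rpow hd.ne'] at h1
  simp at h1
  linarith

variable {X : Type*} [MetricSpace X] [CompactSpace X] [MeasurableSpace X] [BorelSpace X]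

theorem measure_source_count_lt_le (P Q : Measure X) [IsProbabilityMeasure P]
    [IsProbabilityMeasure Q] {r : X → ℝ} (hr : Measurable r) {nP nQ k : ℕ} (j : Fin nQ)
    (h : ∀ᵐ y ∂Q, 4 * (k : ℝ) ≤ nP * P.real (Metric.closedBall y (r y))) :
    sampleLaw P Q nP nQ {x | countIn (Metric.closedBall (x.2 j) (r (x.2 j))) x.1 < k} ≤
      ENNReal.ofReal (Real.exp (-k)) := by
  set E : Set ((Fin nQ → X) × (Fin nP → X)) :=
    {x | countIn (Metric.closedBall (x.1 j) (r (x.1 j))) x.2 < k} with hE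
  have hmE : MeasurableSet E := by
    refine measurableSet_lt (measurable_countIn fun i => ?_) measurable_const
    exact measurableSet_le (Measurable.dist (by fun_prop) (by fun_prop)) (by fun_prop)
  have hswap : sampleLaw P Q nP nQ (Prod.swap ⁻¹' E) =
      (Measure.pi fun _ : Fin nQ => Q).prod (Measure.pi fun _ : Fin nP => P) E :=
    Measure.measurePreserving_swap.measure_preimage hmE.nullMeasurableSet
  refine (Eq.trans_le hswap) (prod_le_of_forall_ae_le _ _ hmE ?_)
  filter_upwards [(measurePreserving_eval (fun _ : Fin nQ => Q) j).quasiMeasurePreserving.ae h]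
    with y hy
  exact measure_countIn_lt_le P Metric.isClosed_closedBall.measurableSet hy

theorem measure_lt_target_count_le (P Q : Measure X) [IsProbabilityMeasure P]
    [IsProbabilityMeasure Q] {r : X → ℝ} (hr : Measurable r) {nP nQ k : ℕ} (j : Fin nQ)
    (h : ∀ y, 8 * (nQ * Q.real (Metric.ball y (r y))) ≤ k) :
    sampleLaw P Q nP nQ {x | k < countIn (Metric.ball (x.2 j) (r (x.2 j))) x.2} ≤
      ENNReal.ofReal (Real.exp (-k)) := by
  obtain ⟨m, rfl⟩ : ∃ m, nQ = m + 1 := ⟨nQ - 1, by have := j.pos; omega⟩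
  set E : Set (X × (Fin m → X)) := {p | k ≤ countIn (Metric.ball p.1 (r p.1)) p.2} with hE
  have hmE : MeasurableSet E := by
    refine measurableSet_le measurable_const (measurable_countIn fun i => ?_)
    exact measurableSet_lt (Measurable.dist (by fun_prop) (by fun_prop)) (by fun_prop)
  -- Condition on the center `x.2 j`. It is at most one of the more than `k` points in the ball, so
  -- at least `k` of the other points lie there.
  have hmp : MeasurePreserving (MeasurableEquiv.piFinSuccAbove (fun _ => X) j ∘ Prod.snd)
      (sampleLaw P Q nP (m + 1)) (Q.prod (Measure.pi fun _ : Fin m => Q)) :=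
    (measurePreserving_piFinSuccAbove (fun _ => Q) j).comp measurePreserving_snd
  refine (measure_mono fun x hx => ?_).trans
    ((hmp.measure_preimage hmE.nullMeasurableSet).trans_le
      (prod_le_of_forall_ae_le _ _ hmE (Filter.Eventually.of_forall fun y => ?_)))
  · have h1 : k < countIn (Metric.ball (x.2 j) (r (x.2 j))) x.2 := hx
    have h2 := countIn_succ_le (Metric.ball (x.2 j) (r (x.2 j))) x.2 j
    change k ≤ countIn (Metric.ball (x.2 j) (r (x.2 j))) (fun i => x.2 (j.succAbove i))
    omega
  · have hmean : 8 * ((m : ℝ) * Q.real (Metric.ball y (r y))) ≤ k := by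
      refine le_trans ?_ (h y)
      gcongr
      exact Nat.le_succ m
    exact measure_le_countIn_le Q Metric.isOpen_ball.measurableSet hmean

theorem measure_not_coveredAt_le {d : ℝ} (hd : 0 < d) {γ : ℝ≥0∞} (hγ : γ ≠ ⊤) {Cγ C' C : ℝ}
    (hCγ : 0 < Cγ) (hC' : 0 < C') (hC₁ : 32 / Cγ ≤ C) (hC₂ : 8 * C' ≤ C)
    (P Q : Measure X) [IsProbabilityMeasure P] [IsProbabilityMeasure Q]
    (hPQ : HasTransferExponent P Q γ Cγ) (hQ : HasBoundedBallMass Q d C')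
    (hdiam : 0 < Metric.diam (univ : Set X)) {nP nQ k : ℕ} (hk : 0 < k) (hkP : 2 * k ≤ nP)
    (hn : C * (nQ : ℝ) ≤ (nP : ℝ) ^ thresholdExponent d γ) (j : Fin nQ) :
    sampleLaw P Q nP nQ
        {x | ¬ CoveredAt (combined x) (sourceIndices nP nQ) k (Sum.inr j)} ≤
      ENNReal.ofReal (2 * Real.exp (-k)) := by
  classical
  have hnQ : (0 : ℝ) < nQ := by exact_mod_cast j.pos
  have hk1 : (1 : ℝ) ≤ k := by exact_mod_cast hk
  rcases le_or_gt nQ k with hkQ | hkQ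
  · -- There are at most `k` target points altogether, and the ball of radius the diameter is
    -- the whole space.
    have hempty : {x : (Fin nP → X) × (Fin nQ → X) |
        ¬ CoveredAt (combined x) (sourceIndices nP nQ) k (Sum.inr j)} = ∅ := by
      refine eq_empty_of_forall_notMem fun x hx => hx ?_
      refine coveredAt_of_card hk (by omega) hdiam ((countIn_le _ x.2).trans hkQ) ?_
      simp only [closedBall_diam_eq_univ, mem_univ, Finset.filter_true, Finset.card_univ,
        Fintype.card_fin]
      omega
    rw [hempty, measure_empty]
    exact zero_le
  have hkQ' : (k : ℝ) < nQ := by exact_mod_cast hkQ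
  set t : ℝ := k / (8 * nQ) with ht
  have ht0 : 0 < t := by positivity
  have ht1 : t ≤ 1 := by
    rw [ht, div_le_one (by positivity)]
    linarith
  obtain ⟨r, hr, hrad⟩ := exists_measurable_radius Q (t := ENNReal.ofReal t)
    (ENNReal.ofReal_le_one.2 ht1) (by simpa using ht0)
  have hball : ∀ y, Q.real (Metric.ball y (r y)) ≤ t := fun y =>
    ENNReal.toReal_le_of_le_ofReal ht0.le (hrad y).2.1
  have hclosed : ∀ y, t ≤ Q.real (Metric.closedBall y (r y)) := fun y =>
    (ENNReal.ofReal_le_iff_le_toReal (measure_ne_top _ _)).1 (hrad y).2.2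
  obtain ⟨A, hA, hAsupp, hQA, htrans⟩ := hPQ
  have hAae : ∀ᵐ y ∂Q, y ∈ A := (prob_compl_eq_zero_iff hA).2 hQA
  have hpos : ∀ y ∈ A, 0 < r y := by
    intro y hy
    refine lt_of_le_of_ne (hrad y).1.1 fun h0 => ?_
    have h1 := (hclosed y).trans (hQ _ (hrad y).1 y (hAsupp hy))
    rw [← h0, zero_div, Real.zero_rpow hd.ne', mul_zero] at h1
    linarith
  have hsource : ∀ y ∈ A, 4 * (k : ℝ) ≤ nP * P.real (Metric.closedBall y (r y)) := by
    intro y hy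
    have h1 := htrans y hy (r y) ⟨hpos y hy, (hrad y).1.2⟩
    rw [transferPow, if_neg hγ] at h1
    rw [thresholdExponent, if_neg hγ] at hn
    exact four_mul_le_mul_mass hd ENNReal.toReal_nonneg hCγ hC' hC₁ hC₂ (Nat.cast_nonneg _) hnQ
      hk1 hn (div_nonneg (hrad y).1.1 hdiam.le) (hclosed y) (hQ _ (hrad y).1 y (hAsupp hy)) h1
  have htarget : ∀ y, 8 * (nQ * Q.real (Metric.ball y (r y))) ≤ k := by
    intro y
    calc 8 * (nQ * Q.real (Metric.ball y (r y))) ≤ 8 * (nQ * t) := by gcongr; exact hball y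
      _ = k := by rw [ht]; field_simp
  have hnull : sampleLaw P Q nP nQ {x | x.2 j ∉ A} = 0 :=
    ((measurePreserving_eval (fun _ : Fin nQ => Q) j).comp
      (measurePreserving_snd (μ := Measure.pi fun _ : Fin nP => P))).quasiMeasurePreserving.ae hAae
  have hsub : {x : (Fin nP → X) × (Fin nQ → X) |
      ¬ CoveredAt (combined x) (sourceIndices nP nQ) k (Sum.inr j)} ⊆
      {x | x.2 j ∉ A} ∪
        ({x | countIn (Metric.closedBall (x.2 j) (r (x.2 j))) x.1 < k} ∪
          {x | k < countIn (Metric.ball (x.2 j) (r (x.2 j))) x.2}) := by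
    intro x hx
    by_contra hcon
    simp only [mem_union, mem_ofPred_eq, not_or, not_not, not_lt] at hcon
    exact hx (coveredAt_of_card hk (by omega) (hpos _ hcon.1) hcon.2.2 hcon.2.1)
  calc sampleLaw P Q nP nQ _
      ≤ 0 + (ENNReal.ofReal (Real.exp (-k)) + ENNReal.ofReal (Real.exp (-k))) := by
        refine (measure_mono hsub).trans ((measure_union_le _ _).trans (add_le_add hnull.le
          ((measure_union_le _ _).trans (add_le_add ?_ ?_))))
        · exact measure_source_count_lt_le P Q hr j (hAae.mono hsource)
        · exact measure_lt_target_count_le P Q hr j htarget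
    _ = ENNReal.ofReal (2 * Real.exp (-k)) := by
        rw [zero_add, ← ENNReal.ofReal_add (Real.exp_nonneg _) (Real.exp_nonneg _), two_mul]

end NotCovered

/-! ### The union bound over target points and scales -/

section UnionBound

theorem one_le_of_hasVCDim_closedBalls {X : Type*} [MetricSpace X]
    (hdiam : 0 < Metric.diam (univ : Set X)) {V : ℕ} (hV : HasVCDim (closedBalls X) V) :
    1 ≤ V := by
  classical
  obtain ⟨a, b, hab⟩ : ∃ a b : X, a ≠ b := by
    by_contra! h
    exact hdiam.ne' (Metric.diam_subsingleton fun a _ b _ => h a b)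
  refine hV.2 ⟨{a}, Finset.card_singleton a, fun T hT => ?_⟩
  rcases Finset.subset_singleton_iff.1 hT with rfl | rfl
  · exact ⟨_, ⟨b, 0, le_rfl, rfl⟩, by simp [hab]⟩
  · exact ⟨_, ⟨a, 0, le_rfl, rfl⟩, by simp⟩

/-- This is where `V ≥ 1` enters: already with one copy of `log (2 n)` the failure probability
`exp (-k₀)` beats the number of target points. -/
theorem exp_neg_kZero_le {V nP nQ : ℕ} {δ : ℝ} (hV : 1 ≤ V) (hδ : 0 < δ)
    (hn : 1 ≤ nP + nQ) : Real.exp (-(kZero V nP nQ δ : ℝ)) ≤ δ / (12 * ((nP : ℝ) + nQ)) := by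
  have hn' : (1 : ℝ) ≤ nP + nQ := by exact_mod_cast hn
  have hV' : (1 : ℝ) ≤ V := by exact_mod_cast hV
  have hlog : 0 ≤ Real.log (2 * ((nP : ℝ) + nQ)) := Real.log_nonneg (by linarith)
  have h1 : Real.log (12 * ((nP : ℝ) + nQ) / δ) ≤ kZero V nP nQ δ := by
    rw [show 12 * ((nP : ℝ) + nQ) / δ = (2 * ((nP : ℝ) + nQ)) * (6 / δ) by ring,
      Real.log_mul (by positivity) (by positivity)]
    refine le_trans ?_ (Nat.le_ceil _)
    nlinarith
  rw [Real.exp_neg, ← inv_div]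
  refine inv_anti₀ (by positivity) ?_
  rw [← Real.log_le_iff_le_exp (by positivity)]
  exact h1

theorem two_mul_le_of_mem_kRange {nP nQ k₀ k : ℕ} (hpos : 0 < max nP nQ) (hk₀ : 0 < k₀)
    (hk : k ∈ kRange nP nQ k₀) :
    0 < k ∧ 2 * k ≤ max nP nQ := by
  simp only [kRange, List.mem_map, List.mem_range] at hk
  obtain ⟨i, hi, rfl⟩ := hk
  refine ⟨by positivity, ?_⟩
  have hk₀' : (0 : ℝ) < k₀ := by exact_mod_cast hk₀
  have hi' : (i : ℤ) ≤ ⌊Real.logb 2 ((max nP nQ : ℕ) / (2 * (k₀ : ℝ)))⌋ := by omega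
  have hpos' : (0 : ℝ) < (max nP nQ : ℕ) := by exact_mod_cast hpos
  have h1 : (i : ℝ) ≤ Real.logb 2 ((max nP nQ : ℕ) / (2 * (k₀ : ℝ))) := by
    exact_mod_cast Int.le_floor.1 hi'
  rw [Real.le_logb_iff_rpow_le one_lt_two (by positivity), Real.rpow_natCast,
    le_div_iff₀ (by positivity)] at h1
  have h2 : ((2 * (2 ^ i * k₀) : ℕ) : ℝ) ≤ (max nP nQ : ℕ) := by
    push_cast at h1 ⊢
    linarith
  exact_mod_cast h2

theorem sum_exp_neg_two_pow_mul_le {k₀ : ℕ} (h : Real.exp (-(k₀ : ℝ)) ≤ 1 / 2) (L : ℕ) :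
    ∑ i ∈ Finset.range L, Real.exp (-((2 ^ i * k₀ : ℕ) : ℝ)) ≤ 2 * Real.exp (-(k₀ : ℝ)) := by
  set q := Real.exp (-(k₀ : ℝ)) with hq
  have hq0 : 0 ≤ q := Real.exp_nonneg _
  have hterm : ∀ i, Real.exp (-((2 ^ i * k₀ : ℕ) : ℝ)) ≤ q * (1 / 2) ^ i := by
    intro i
    rw [show -((2 ^ i * k₀ : ℕ) : ℝ) = ((2 ^ i : ℕ) : ℝ) * (-(k₀ : ℝ)) by push_cast; ring,
      Real.exp_nat_mul, ← hq]
    calc q ^ 2 ^ i ≤ q ^ (i + 1) := pow_le_pow_of_le_one hq0 (by linarith) Nat.lt_two_pow_self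
      _ = q * q ^ i := pow_succ' q i
      _ ≤ q * (1 / 2) ^ i := by gcongr
  calc _ ≤ ∑ i ∈ Finset.range L, q * (1 / 2) ^ i := Finset.sum_le_sum fun i _ => hterm i
    _ = q * ∑ i ∈ Finset.range L, (1 / 2 : ℝ) ^ i := by rw [Finset.mul_sum]
    _ ≤ q * 2 := by gcongr; exact sum_geometric_two_le L
    _ = 2 * q := mul_comm _ _

theorem le_measure_queried_eq_empty {X : Type*} [MetricSpace X] [MeasurableSpace X]
    (P Q : Measure X) [IsProbabilityMeasure P] [IsProbabilityMeasure Q] {δ : ℝ} (hδ : 0 < δ)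
    (hδ1 : δ < 1) {nP nQ k₀ : ℕ} (hn : 1 ≤ nP + nQ)
    (hk₀ : Real.exp (-(k₀ : ℝ)) ≤ δ / (12 * ((nP : ℝ) + nQ)))
    (h : ∀ k ∈ kRange nP nQ k₀, ∀ j, sampleLaw P Q nP nQ
      {x | ¬ CoveredAt (combined x) (sourceIndices nP nQ) k (Sum.inr j)} ≤
        ENNReal.ofReal (2 * Real.exp (-k))) :
    ENNReal.ofReal (1 - δ) ≤ sampleLaw P Q nP nQ {x | queried k₀ x = ∅} := by
  have hn' : (1 : ℝ) ≤ nP + nQ := by exact_mod_cast hn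
  set G : Set ((Fin nP → X) × (Fin nQ → X)) := {x | queried k₀ x = ∅} with hG
  obtain ⟨L, hL⟩ : ∃ L, kRange nP nQ k₀ = (List.range L).map fun i => 2 ^ i * k₀ := ⟨_, rfl⟩
  let B : Fin nQ → ℕ → Set ((Fin nP → X) × (Fin nQ → X)) := fun j i =>
    {x | ¬ CoveredAt (combined x) (sourceIndices nP nQ) (2 ^ i * k₀) (Sum.inr j)}
  have hsub : Gᶜ ⊆ ⋃ j ∈ (Finset.univ : Finset (Fin nQ)), ⋃ i ∈ Finset.range L, B j i := by
    intro x hx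
    by_contra hcon
    refine hx (queried_eq_empty k₀ x fun k hk j => ?_)
    rw [hL, List.mem_map] at hk
    obtain ⟨i, hi, rfl⟩ := hk
    by_contra hnot
    simp only [mem_iUnion, not_exists] at hcon
    exact hcon j (Finset.mem_univ j) i (Finset.mem_range.2 (List.mem_range.1 hi)) hnot
  have hhalf : Real.exp (-(k₀ : ℝ)) ≤ 1 / 2 := by
    refine hk₀.trans ((div_le_iff₀ (by positivity)).2 ?_)
    linarith
  have hbad : sampleLaw P Q nP nQ Gᶜ ≤ ENNReal.ofReal δ := by
    calc sampleLaw P Q nP nQ Gᶜ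
        ≤ ∑ j : Fin nQ, ∑ i ∈ Finset.range L, sampleLaw P Q nP nQ (B j i) :=
          (measure_mono hsub).trans ((measure_biUnion_finset_le _ _).trans
            (Finset.sum_le_sum fun j _ => measure_biUnion_finset_le _ _))
      _ ≤ ∑ j : Fin nQ, ∑ i ∈ Finset.range L,
            ENNReal.ofReal (2 * Real.exp (-((2 ^ i * k₀ : ℕ) : ℝ))) := by
          refine Finset.sum_le_sum fun j _ => Finset.sum_le_sum fun i hi => h _ ?_ j
          rw [hL]
          exact List.mem_map.2 ⟨i, List.mem_range.2 (Finset.mem_range.1 hi), rfl⟩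
      _ = ENNReal.ofReal
            (nQ * (2 * ∑ i ∈ Finset.range L, Real.exp (-((2 ^ i * k₀ : ℕ) : ℝ)))) := by
          simp only [← ENNReal.ofReal_sum_of_nonneg fun i _ =>
            mul_nonneg zero_le_two (Real.exp_nonneg _)]
          rw [Finset.sum_const, Finset.card_univ, Fintype.card_fin, nsmul_eq_mul,
            ENNReal.ofReal_mul (Nat.cast_nonneg _), ENNReal.ofReal_natCast, Finset.mul_sum]
      _ ≤ ENNReal.ofReal δ := by
          refine ENNReal.ofReal_le_ofReal ?_
          have h1 := sum_exp_neg_two_pow_mul_le hhalf L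
          have h2 : Real.exp (-(k₀ : ℝ)) * (12 * ((nP : ℝ) + nQ)) ≤ δ :=
            (le_div_iff₀ (by positivity)).1 hk₀
          have h3 : (nQ : ℝ) ≤ (nP : ℝ) + nQ := by linarith [Nat.cast_nonneg (α := ℝ) nP]
          calc _ ≤ ((nP : ℝ) + nQ) * (2 * (2 * Real.exp (-(k₀ : ℝ)))) := by gcongr
            _ ≤ δ := by nlinarith
  have hprob : IsProbabilityMeasure (sampleLaw P Q nP nQ) := by
    unfold sampleLaw
    infer_instance
  -- The event is not known to be measurable; subadditivity of the outer measure suffices.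
  have htotal : 1 ≤ sampleLaw P Q nP nQ G + ENNReal.ofReal δ := by
    calc (1 : ℝ≥0∞) = sampleLaw P Q nP nQ (G ∪ Gᶜ) := by rw [union_compl_self, measure_univ]
      _ ≤ _ := (measure_union_le _ _).trans (by gcongr)
  rw [ENNReal.ofReal_sub _ hδ.le, ENNReal.ofReal_one]
  exact tsub_le_iff_right.2 htotal

theorem le_of_mul_le_rpow_thresholdExponent {d C : ℝ} (hd : 0 < d) {γ : ℝ≥0∞} (hC : 1 < C)
    {nP nQ : ℕ} (hnQ : 1 ≤ nQ) (h : C * (nQ : ℝ) ≤ (nP : ℝ) ^ thresholdExponent d γ) :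
    γ ≠ ⊤ ∧ nQ ≤ nP := by
  have hnQ' : (1 : ℝ) ≤ nQ := by exact_mod_cast hnQ
  have hlt : (1 : ℝ) < (nP : ℝ) ^ thresholdExponent d γ := by nlinarith
  by_cases hγ : γ = ⊤
  · simp [thresholdExponent, hγ] at hlt
  refine ⟨hγ, ?_⟩
  have hg : 0 ≤ γ.toReal := ENNReal.toReal_nonneg
  rw [thresholdExponent, if_neg hγ] at h hlt
  have hpos : 1 ≤ nP := by
    by_contra h0
    rw [show nP = 0 by omega, Nat.cast_zero, Real.zero_rpow (by positivity)] at hlt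
    linarith
  have h1 : (nP : ℝ) ^ (d / (d + γ.toReal)) ≤ nP := by
    refine (Real.rpow_le_rpow_of_exponent_le (by exact_mod_cast hpos)
      ((div_le_one (by positivity)).2 (by linarith))).trans_eq (Real.rpow_one _)
  have h2 : (nQ : ℝ) ≤ nP := by nlinarith
  exact_mod_cast h2

end UnionBound

end LabelingThreshold

/-! ### The covering property and the threshold -/

theorem theorem4 (d : ℝ) (hd : 1 ≤ d) (γ : ℝ≥0∞) (Cγ : ℝ) (hCγ₀ : 0 < Cγ) (hCγ₁ : Cγ ≤ 1)
    (C' : ℝ) (hC' : 0 < C') :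
    ∃ C : ℝ, 0 < C ∧
      ∀ (X : Type*) [MetricSpace X] [CompactSpace X] [MeasurableSpace X] [BorelSpace X]
        (V : ℕ), LabelingThreshold.HasVCDim (LabelingThreshold.closedBalls X) V →
      ∀ (P Q : Measure X) [IsProbabilityMeasure P] [IsProbabilityMeasure Q],
        LabelingThreshold.HasTransferExponent P Q γ Cγ →
        LabelingThreshold.HasBoundedBallMass Q d C' →
      ∀ δ : ℝ, 0 < δ → δ < 1 →
      ∀ nP nQ : ℕ, 1 ≤ max nP nQ →
        (∀ x : (Fin nP → X) × (Fin nQ → X),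
          ∀ k ∈ LabelingThreshold.kRange nP nQ (LabelingThreshold.kZero V nP nQ δ),
            LabelingThreshold.IsCover (LabelingThreshold.combined x)
              (LabelingThreshold.buildCover (LabelingThreshold.kZero V nP nQ δ) x) k) ∧
        (C * (nQ : ℝ) ≤ (nP : ℝ) ^ LabelingThreshold.thresholdExponent d γ →
          ENNReal.ofReal (1 - δ) ≤
            LabelingThreshold.sampleLaw P Q nP nQ
              {x | LabelingThreshold.queried (LabelingThreshold.kZero V nP nQ δ) x = ∅}) := by
  have hd0 : 0 < d := zero_lt_one.trans_le hd
  have h32 : 32 ≤ 32 / Cγ := (le_div_iff₀ hCγ₀).2 (by linarith)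
  refine ⟨32 / Cγ + 8 * C', by positivity, ?_⟩
  intro X _ _ _ _ V hV P Q _ _ hPQ hQ δ hδ hδ1 nP nQ hmax
  refine ⟨fun x k hk => LabelingThreshold.isCover_buildCover _ x hk, fun hn => ?_⟩
  have hsupp : Q.support.Nonempty := by
    obtain ⟨A, -, hA, hQA, -⟩ := hPQ
    exact (nonempty_of_measure_ne_zero (by rw [hQA]; exact one_ne_zero)).mono hA
  have hdiam := LabelingThreshold.diam_pos_of_hasBoundedBallMass hd0 hQ hsupp
  have hsum : 1 ≤ nP + nQ := by omega
  have hk₀ := LabelingThreshold.exp_neg_kZero_le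
    (LabelingThreshold.one_le_of_hasVCDim_closedBalls hdiam hV) hδ hsum
  refine LabelingThreshold.le_measure_queried_eq_empty P Q hδ hδ1 hsum hk₀ fun k hk j => ?_
  obtain ⟨hγ, hle⟩ := LabelingThreshold.le_of_mul_le_rpow_thresholdExponent hd0
    (by linarith) j.pos hn
  have hk₀pos : 0 < LabelingThreshold.kZero V nP nQ δ := by
    by_contra h0
    have hsum' : (1 : ℝ) ≤ nP + nQ := by exact_mod_cast hsum
    rw [Nat.eq_zero_of_not_pos h0, Nat.cast_zero, neg_zero, Real.exp_zero,
      le_div_iff₀ (by positivity)] at hk₀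
    linarith
  obtain ⟨hkpos, h2k⟩ := LabelingThreshold.two_mul_le_of_mem_kRange hmax hk₀pos hk
  rw [max_eq_left hle] at h2k
  exact LabelingThreshold.measure_not_coveredAt_le hd0 hγ hCγ₀ hC' (by linarith) (by linarith)
    P Q hPQ hQ hdiam hkpos h2k hn j
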